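/- Let $\mathcal{Q}_3$ be the set of Borel probability measures $\mu$ on $\mathbb{R}$ with $\int |x|^3\,d\mu<\infty$, $\int x\,d\mu=0$ and $\int x^2\,d\mu=1$. For $\mu\in\mathcal{Q}_3$ let $G_\mu(z)=\int_{\mathbb{R}}\frac{d\mu(t)}{z-t}$, $z\in\mathbb{C}\setminus\mathbb{R}$, be its Cauchy transform, and let $\Omega\subset\mathbb{C}$ be the union of the two open discs of radius $1/4$ centred at $-i/4$ and $i/4$. The $R$-transform $R_\mu$ of $\mu$ is the analytic function on $\Omega$ such that, for all $z\in\Omega$, $$R_\mu(z)+\tfrac1z\in\mathbb{C}\setminus\mathbb{R},\qquad G_\mu\bigl(R_\mu(z)+\tfrac1z\bigr)=z,$$ and $zR_\mu(z)\to0$ as $z=iy\to0$, $y\in\mathbb{R}\setminus\{0\}$. For $\mu,\nu\in\mathcal{Q}_3$ put $$d(\mu,\nu)=\sup_{0<y\le 1/4}\frac{|R_\mu(iy)-R_\nu(iy)|}{y^2}\in[0,\infty].$$ Lemma. For every $\mu\in\mathcal{Q}_3$ the $R$-transform $R_\mu$ exists and is unique on $\Omega$, and with $\alpha_3=\int x^3\,d\mu$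 it satisfies $R_\mu(z)=z+\alpha_3z^2+o(z^2)$ as $z=iy\to0$, $y\in\mathbb{R}\setminus\{0\}$. Moreover $d$ is a finite metric on $\mathcal{Q}_3$: for all $\mu,\nu,\xi\in\mathcal{Q}_3$ one has $d(\mu,\nu)<\infty$, $d(\mu,\nu)=0$ if and only if $\mu=\nu$, $d(\mu,\nu)=d(\nu,\mu)$, and $d(\mu,\xi)\le d(\mu,\nu)+d(\nu,\xi)$. Finally, if $\nu_n,\mu\in\mathcal{Q}_3$ and $d(\nu_n,\mu)\to0$, then $\nu_n\to\mu$ weakly. -/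

import Mathlib

open Filter Topology MeasureTheory Set Asymptotics
open scoped ENNReal

noncomputable section

/-- The probability measures on `ℝ` with finite third (absolute) moment, mean `0` and
variance `1`. -/
def Q3 : Set (ProbabilityMeasure ℝ) :=
  {μ | Integrable (fun x : ℝ => |x| ^ 3) (μ : Measure ℝ) ∧
    ∫ x : ℝ, x ∂(μ : Measure ℝ) = 0 ∧ ∫ x : ℝ, x ^ 2 ∂(μ : Measure ℝ) = 1}

/-- The Cauchy transform `G_μ(z) = ∫ 1 / (z - t) dμ(t)`, meant for `z ∈ ℂ \ ℝ`. -/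
def cauchyTransform (μ : Measure ℝ) (z : ℂ) : ℂ :=
  ∫ t : ℝ, 1 / (z - (t : ℂ)) ∂μ

/-- The domain of the R-transform of a measure of variance `1`: the open disc with centre `-i/4`
and radius `1/4`, together with its mirror image in the real axis. -/
def rDomain : Set ℂ :=
  Metric.ball (-(Complex.I / 4)) (1 / 4) ∪ Metric.ball (Complex.I / 4) (1 / 4)

/-- `R` is an R-transform of `μ` (of variance `1`): it is an analytic solution of
`G_μ (R z + 1 / z) = z` on `rDomain`, where `R z + 1 / z` lies in the domain `ℂ \ ℝ` of `G_μ`.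
Since `G_μ` need not be injective on a half-plane, the branch is fixed as usual by
`z R(z) → 0` as `z → 0` along the imaginary axis, that is, `z ↦ R z + 1 / z` is the inverse of
`G_μ` near infinity. -/
structure IsRTransform (μ : Measure ℝ) (R : ℂ → ℂ) : Prop where
  analytic : AnalyticOnNhd ℂ R rDomain
  im_ne_zero : ∀ z ∈ rDomain, (R z + 1 / z).im ≠ 0
  cauchy_eq : ∀ z ∈ rDomain, cauchyTransform μ (R z + 1 / z) = z
  branch : Tendsto (fun y : ℝ => (y * Complex.I) * R (y * Complex.I)) (𝓝[≠] 0) (𝓝 0)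

open Classical in
/-- The R-transform of `μ ∈ Q3` (only its values on `rDomain` are meaningful). -/
def rTransform (μ : Q3) : ℂ → ℂ :=
  if h : ∃ R, IsRTransform (μ.1 : Measure ℝ) R then h.choose else 0

/-- `d(μ, ν) = sup_{0 < y ≤ 1/4} |R_μ(iy) - R_ν(iy)| / y²`, a priori in `[0, ∞]`. -/
def rDist (μ ν : Q3) : ℝ≥0∞ :=
  ⨆ y ∈ Ioc (0 : ℝ) (1 / 4),
    ENNReal.ofReal (‖rTransform μ (y * Complex.I) - rTransform ν (y * Complex.I)‖ / y ^ 2)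

end

/-! Write `F = 1 / G_μ` and `D(z) = z - F(z)`. Everything rests on Hilbert space estimates in
`L²(μ)` for the kernel `k_z(t) = F(z)/(z - t) - 1`, which has mean zero. Three identities hold: `∫ t
k_z = D(z)`, `∫ |k_z|² = -Im D(z) / Im z`, and `D(z) - D(w) = (w - z) ∫ k_z k_w`. As `∫ t² = 1`,
Cauchy–Schwarz gives `|D(z)| ≤ 1/|Im z|` and a Lipschitz bound with constant `1/(|Im z| |Im w|)`; no
integral representation of `F` is needed.

Hence for `|Im w| > 2` the map `z ↦ w + D(z)` contracts the closed unit disc about `w`, and its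
fixed point `ζ` solves `F(ζ) = w`. Inversion carries `rDomain` into `|Im w| > 2`, so `R(z) = ζ(1/z)
- 1/z` is an R-transform (`IsStandardized.isRTransform`). The branch condition puts any other
solution in the region where `F` is injective, and the identity theorem gives uniqueness
(`IsRTransform.eqOn`). Expanding `∫ t k_ζ` to second order in `z` yields the asymptotics and the
finiteness of `d`.

For weak convergence, the common variance gives tightness. The Cauchy transform of any limit point
agrees with `G_μ` on a curve, hence on the lower half-plane, and Stieltjes inversion identifies the
measure. Constant sequences then show that `d` separates points. -/

open scoped BoundedContinuousFunction

noncomputable section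

/-! ### The Cauchy transform off the real axis -/

lemma abs_im_le_norm_sub_ofReal (z : ℂ) (t : ℝ) : |z.im| ≤ ‖z - t‖ := by
  simpa using Complex.abs_im_le_norm (z - t)

lemma sub_ofReal_ne_zero {z : ℂ} (hz : z.im ≠ 0) (t : ℝ) : z - (t : ℂ) ≠ 0 := by
  intro h
  apply hz
  simpa using congrArg Complex.im h

lemma norm_one_div_sub_ofReal_le {z : ℂ} (hz : z.im ≠ 0) (t : ℝ) :
    ‖1 / (z - (t : ℂ))‖ ≤ 1 / |z.im| := by
  rw [norm_div, norm_one]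
  exact one_div_le_one_div_of_le (abs_pos.2 hz) (abs_im_le_norm_sub_ofReal z t)

lemma continuous_one_div_sub_ofReal {z : ℂ} (hz : z.im ≠ 0) :
    Continuous fun t : ℝ => 1 / (z - (t : ℂ)) :=
  continuous_const.div (by fun_prop) (sub_ofReal_ne_zero hz)

lemma memLp_top_one_div_sub_ofReal (μ : Measure ℝ) {z : ℂ} (hz : z.im ≠ 0) :
    MemLp (fun t : ℝ => 1 / (z - (t : ℂ))) ∞ μ :=
  memLp_top_of_bound (continuous_one_div_sub_ofReal hz).aestronglyMeasurable _
    (Eventually.of_forall (norm_one_div_sub_ofReal_le hz))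

lemma memLp_one_div_sub_ofReal (μ : Measure ℝ) [IsFiniteMeasure μ] {z : ℂ} (hz : z.im ≠ 0)
    (p : ℝ≥0∞) : MemLp (fun t : ℝ => 1 / (z - (t : ℂ))) p μ :=
  (memLp_top_one_div_sub_ofReal μ hz).mono_exponent le_top

lemma integrable_one_div_sub_ofReal (μ : Measure ℝ) [IsFiniteMeasure μ] {z : ℂ}
    (hz : z.im ≠ 0) : Integrable (fun t : ℝ => 1 / (z - (t : ℂ))) μ :=
  memLp_one_iff_integrable.1 (memLp_one_div_sub_ofReal μ hz 1)

lemma differentiableAt_cauchyTransform (μ : Measure ℝ) [IsFiniteMeasure μ] {z : ℂ}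
    (hz : z.im ≠ 0) : DifferentiableAt ℂ (cauchyTransform μ) z := by
  have h := (hasDerivAt_resolventTransform (μ := μ) z (by
    rintro ⟨t, -, ht⟩
    apply hz
    rw [← ht]
    simp)).differentiableAt.neg
  have heq : cauchyTransform μ = -resolventTransform μ := by
    ext w
    simp only [cauchyTransform, resolventTransform_apply, Pi.neg_apply, ← integral_neg]
    congr 1
    ext t
    simp only [resolvent, Ring.inverse_eq_inv', Complex.coe_algebraMap, one_div]
    rw [← inv_neg, neg_sub]
  rwa [heq]

lemma integrable_norm_one_div_sub_ofReal_sq (μ : Measure ℝ) [IsFiniteMeasure μ] {z : ℂ}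
    (hz : z.im ≠ 0) : Integrable (fun t : ℝ => ‖1 / (z - (t : ℂ))‖ ^ 2) μ :=
  (memLp_one_div_sub_ofReal μ hz 2).integrable_norm_pow (by norm_num)

lemma im_cauchyTransform (μ : Measure ℝ) [IsFiniteMeasure μ] {z : ℂ} (hz : z.im ≠ 0) :
    (cauchyTransform μ z).im = -z.im * ∫ t : ℝ, ‖1 / (z - (t : ℂ))‖ ^ 2 ∂μ := by
  have h : (cauchyTransform μ z).im = ∫ t : ℝ, (1 / (z - (t : ℂ))).im ∂μ := by
    simpa [cauchyTransform] using (integral_im (integrable_one_div_sub_ofReal μ hz)).symm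
  rw [h, ← integral_const_mul]
  congr 1
  ext t
  rw [norm_div, norm_one, div_pow, one_pow, ← Complex.normSq_eq_norm_sq, one_div, Complex.inv_im]
  simp
  ring

/-- A zero of `G_μ` would make `∫ |1/(z - t)|²` vanish, although the integrand is positive
everywhere. -/
lemma cauchyTransform_ne_zero (μ : Measure ℝ) [IsProbabilityMeasure μ] {z : ℂ}
    (hz : z.im ≠ 0) : cauchyTransform μ z ≠ 0 := by
  intro h
  have h1 := im_cauchyTransform μ hz
  rw [h, Complex.zero_im, eq_comm, mul_eq_zero, neg_eq_zero, or_iff_right hz,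
    integral_eq_zero_iff_of_nonneg (fun t => by positivity)
      (integrable_norm_one_div_sub_ofReal_sq μ hz)] at h1
  obtain ⟨t, ht⟩ := h1.exists
  simp [sub_ofReal_ne_zero hz t] at ht

lemma norm_cauchyTransform_sub_le (μ : Measure ℝ) [IsProbabilityMeasure μ] {z w : ℂ}
    (hz : z.im ≠ 0) (hw : w.im ≠ 0) :
    ‖cauchyTransform μ z - cauchyTransform μ w‖ ≤ ‖z - w‖ / (|z.im| * |w.im|) := by
  rw [cauchyTransform, cauchyTransform, ← integral_sub (integrable_one_div_sub_ofReal μ hz)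
    (integrable_one_div_sub_ofReal μ hw)]
  refine (norm_integral_le_of_norm_le_const (C := ‖z - w‖ / (|z.im| * |w.im|))
    (Eventually.of_forall fun t => ?_)).trans (by simp)
  have h : 1 / (z - (t : ℂ)) - 1 / (w - (t : ℂ))
      = -(z - w) * ((1 / (z - (t : ℂ))) * (1 / (w - (t : ℂ)))) := by
    have := sub_ofReal_ne_zero hz t
    have := sub_ofReal_ne_zero hw t
    field_simp
    ring
  rw [h, norm_mul, norm_mul, norm_neg, div_eq_mul_one_div ‖z - w‖, ← one_div_mul_one_div]
  gcongr
  · exact norm_one_div_sub_ofReal_le hz t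
  · exact norm_one_div_sub_ofReal_le hw t

/-- Cauchy–Schwarz without conjugation: the quadratic `s ↦ ∫ (‖f‖ - s ‖g‖)²` is nonnegative, so its
discriminant is at most `0`. -/
lemma norm_integral_mul_sq_le {α : Type*} [MeasurableSpace α] {μ : Measure α} {f g : α → ℂ}
    (hf : MemLp f 2 μ) (hg : MemLp g 2 μ) :
    ‖∫ x, f x * g x ∂μ‖ ^ 2 ≤ (∫ x, ‖f x‖ ^ 2 ∂μ) * ∫ x, ‖g x‖ ^ 2 ∂μ := by
  have hf2 : Integrable (fun x => ‖f x‖ ^ 2) μ := hf.integrable_norm_pow (by norm_num)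
  have hg2 : Integrable (fun x => ‖g x‖ ^ 2) μ := hg.integrable_norm_pow (by norm_num)
  have hfg : Integrable (fun x => ‖f x‖ * ‖g x‖) μ := hf.norm.integrable_mul hg.norm
  have h1 : ‖∫ x, f x * g x ∂μ‖ ≤ ∫ x, ‖f x‖ * ‖g x‖ ∂μ := by
    simpa only [norm_mul] using norm_integral_le_integral_norm (μ := μ) fun x => f x * g x
  have h2 : discrim (∫ x, ‖g x‖ ^ 2 ∂μ) (-2 * ∫ x, ‖f x‖ * ‖g x‖ ∂μ) (∫ x, ‖f x‖ ^ 2 ∂μ) ≤ 0 := by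
    refine discrim_le_zero fun s => ?_
    have h3 : ∫ x, (‖f x‖ - s * ‖g x‖) ^ 2 ∂μ
        = (∫ x, ‖g x‖ ^ 2 ∂μ) * (s * s) + (-2 * ∫ x, ‖f x‖ * ‖g x‖ ∂μ) * s
          + ∫ x, ‖f x‖ ^ 2 ∂μ := by
      have h4 : (fun x => (‖f x‖ - s * ‖g x‖) ^ 2) = fun x =>
          (s * s) * ‖g x‖ ^ 2 + (-2 * s) * (‖f x‖ * ‖g x‖) + ‖f x‖ ^ 2 := by
        ext x; ring
      rw [h4, integral_add (by fun_prop) hf2, integral_add (by fun_prop) (by fun_prop), integral_const_mul, integral_const_mul]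
      ring
    rw [← h3]
    exact integral_nonneg fun x => sq_nonneg _
  have h5 : ‖∫ x, f x * g x ∂μ‖ ^ 2 ≤ (∫ x, ‖f x‖ * ‖g x‖ ∂μ) ^ 2 := by gcongr
  rw [discrim] at h2
  nlinarith

/-! ### The reciprocal Cauchy transform of a standardized measure -/

/-- A measure on `ℝ` with mean `0` and variance `1`. -/
structure IsStandardized (μ : Measure ℝ) : Prop where
  memLp : MemLp (fun x : ℝ => x) 2 μ
  mean : ∫ x : ℝ, x ∂μ = 0
  variance : ∫ x : ℝ, x ^ 2 ∂μ = 1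

/-- The difference `z - 1 / G_μ(z)` between the identity and the reciprocal Cauchy transform. -/
def cauchyDefect (μ : Measure ℝ) (z : ℂ) : ℂ := z - 1 / cauchyTransform μ z

/-- The projection of `t ↦ 1 / (G_μ(z) (z - t))` to the orthogonal complement of the constants. -/
def centeredKernel (μ : Measure ℝ) (z : ℂ) (t : ℝ) : ℂ :=
  1 / cauchyTransform μ z * (1 / (z - t)) - 1

section

variable {μ : Measure ℝ}

lemma differentiableAt_cauchyDefect [IsProbabilityMeasure μ] {z : ℂ} (hz : z.im ≠ 0) :
    DifferentiableAt ℂ (cauchyDefect μ) z :=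
  differentiableAt_id.sub ((differentiableAt_const _).div (differentiableAt_cauchyTransform μ hz)
    (cauchyTransform_ne_zero μ hz))

lemma memLp_centeredKernel [IsProbabilityMeasure μ] {z : ℂ} (hz : z.im ≠ 0) :
    MemLp (centeredKernel μ z) 2 μ :=
  ((memLp_one_div_sub_ofReal μ hz 2).const_mul _).sub (memLp_const 1)

lemma IsStandardized.memLp_ofReal (h : IsStandardized μ) :
    MemLp (fun t : ℝ => (t : ℂ)) 2 μ := h.memLp.ofReal

lemma IsStandardized.integral_ofReal_eq_zero (h : IsStandardized μ) :
    ∫ t : ℝ, (t : ℂ) ∂μ = 0 := by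
  rw [integral_complex_ofReal, h.mean, Complex.ofReal_zero]

lemma IsStandardized.integral_mul_centeredKernel [IsProbabilityMeasure μ]
    (h : IsStandardized μ) {z : ℂ} (hz : z.im ≠ 0) :
    ∫ t : ℝ, (t : ℂ) * centeredKernel μ z t ∂μ = cauchyDefect μ z := by
  have hG := cauchyTransform_ne_zero μ hz
  have hi := integrable_one_div_sub_ofReal μ hz
  have ht : Integrable (fun t : ℝ => (t : ℂ)) μ := h.memLp_ofReal.integrable one_le_two
  -- Uses `t/(z - t) = z/(z - t) - 1`.
  have h1 : (fun t : ℝ => (t : ℂ) * centeredKernel μ z t) = fun t : ℝ =>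
      (1 / cauchyTransform μ z * z) * (1 / (z - t)) - 1 / cauchyTransform μ z - t := by
    ext t
    have := sub_ofReal_ne_zero hz t
    rw [centeredKernel]
    field_simp
    ring
  rw [h1, integral_sub (by fun_prop) ht, integral_sub (by fun_prop) (by fun_prop),
    integral_const_mul, h.integral_ofReal_eq_zero, ← cauchyTransform, cauchyDefect]
  simp
  field_simp

/-- Expanding the square, the cross term integrates to `Re (F G) = 1`, and `im_cauchyTransform`
turns the quadratic term into `Im F / Im z`. -/
lemma integral_norm_centeredKernel_sq [IsProbabilityMeasure μ] {z : ℂ} (hz : z.im ≠ 0) :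
    ∫ t : ℝ, ‖centeredKernel μ z t‖ ^ 2 ∂μ = -(cauchyDefect μ z).im / z.im := by
  have hG := cauchyTransform_ne_zero μ hz
  have hi := integrable_one_div_sub_ofReal μ hz
  have hi2 := integrable_norm_one_div_sub_ofReal_sq μ hz
  have him := im_cauchyTransform μ hz
  set F := 1 / cauchyTransform μ z with hF
  have hre : Integrable (fun t : ℝ => (F * (1 / (z - t))).re) μ := (hi.const_mul F).re
  have h1 : (fun t : ℝ => ‖centeredKernel μ z t‖ ^ 2) = fun t : ℝ =>
      ‖F‖ ^ 2 * ‖1 / (z - (t : ℂ))‖ ^ 2 - 2 * (F * (1 / (z - t))).re + 1 := by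
    ext t
    rw [centeredKernel, ← hF, ← mul_pow, ← norm_mul, ← Complex.normSq_eq_norm_sq,
      ← Complex.normSq_eq_norm_sq, Complex.normSq_sub]
    simp
    ring
  have h2 : ∫ t : ℝ, (F * (1 / (z - t))).re ∂μ = 1 := by
    have h3 : ∫ t : ℝ, (F * (1 / (z - t))).re ∂μ = (∫ t : ℝ, F * (1 / (z - t)) ∂μ).re := by
      simpa using integral_re (hi.const_mul F)
    rw [h3, integral_const_mul, ← cauchyTransform, hF, one_div_mul_cancel hG, Complex.one_re]
  rw [h1, integral_add (by fun_prop) (by fun_prop), integral_sub (by fun_prop) (by fun_prop),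
    integral_const_mul, integral_const_mul, h2]
  have h4 : F.im = -‖F‖ ^ 2 * (cauchyTransform μ z).im := by
    rw [hF, ← Complex.normSq_eq_norm_sq, one_div, Complex.inv_im, Complex.normSq_inv]
    ring
  have h5 : (cauchyDefect μ z).im = z.im - F.im := by simp [cauchyDefect, hF]
  rw [h5, h4, him]
  simp
  field_simp
  ring

lemma IsStandardized.norm_cauchyDefect_sq_le [IsProbabilityMeasure μ]
    (h : IsStandardized μ) {z : ℂ} (hz : z.im ≠ 0) :
    ‖cauchyDefect μ z‖ ^ 2 ≤ ∫ t : ℝ, ‖centeredKernel μ z t‖ ^ 2 ∂μ := by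
  have := norm_integral_mul_sq_le h.memLp_ofReal (memLp_centeredKernel (μ := μ) hz)
  simpa [h.integral_mul_centeredKernel hz, h.variance] using this

lemma integral_norm_centeredKernel_sq_le_div [IsProbabilityMeasure μ] {z : ℂ} (hz : z.im ≠ 0) :
    ∫ t : ℝ, ‖centeredKernel μ z t‖ ^ 2 ∂μ ≤ ‖cauchyDefect μ z‖ / |z.im| := by
  rw [integral_norm_centeredKernel_sq hz]
  refine (le_abs_self _).trans ?_
  rw [abs_div, abs_neg]
  gcongr
  exact Complex.abs_im_le_norm _

/-- The two preceding bounds combine to `|D|² ≤ |D| / |Im z|`; cancel `|D|` unless it is zero. -/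
lemma IsStandardized.norm_cauchyDefect_le [IsProbabilityMeasure μ]
    (h : IsStandardized μ) {z : ℂ} (hz : z.im ≠ 0) : ‖cauchyDefect μ z‖ ≤ 1 / |z.im| := by
  have h1 := (h.norm_cauchyDefect_sq_le hz).trans (integral_norm_centeredKernel_sq_le_div hz)
  rcases (norm_nonneg (cauchyDefect μ z)).eq_or_lt with h0 | h0
  · rw [← h0]
    positivity
  · rw [sq, div_eq_mul_one_div] at h1
    exact le_of_mul_le_mul_left h1 h0

lemma IsStandardized.integral_norm_centeredKernel_sq_le [IsProbabilityMeasure μ]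
    (h : IsStandardized μ) {z : ℂ} (hz : z.im ≠ 0) :
    ∫ t : ℝ, ‖centeredKernel μ z t‖ ^ 2 ∂μ ≤ (1 / |z.im|) ^ 2 := by
  refine (integral_norm_centeredKernel_sq_le_div hz).trans ?_
  rw [sq, div_eq_mul_one_div]
  gcongr
  exact h.norm_cauchyDefect_le hz

/-- The resolvent identity `(w - z)/((z - t)(w - t)) = 1/(z - t) - 1/(w - t)` makes the product of
kernels linear in the two resolvents. -/
lemma cauchyDefect_sub [IsProbabilityMeasure μ] {z w : ℂ} (hz : z.im ≠ 0) (hw : w.im ≠ 0) :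
    cauchyDefect μ z - cauchyDefect μ w
      = (w - z) * ∫ t : ℝ, centeredKernel μ z t * centeredKernel μ w t ∂μ := by
  have hG := cauchyTransform_ne_zero μ hz
  have hG' := cauchyTransform_ne_zero μ hw
  have hi := integrable_one_div_sub_ofReal μ hz
  have hi' := integrable_one_div_sub_ofReal μ hw
  rw [← integral_const_mul]
  set F := 1 / cauchyTransform μ z with hF
  set F' := 1 / cauchyTransform μ w with hF'
  have h1 : (fun t : ℝ => (w - z) * (centeredKernel μ z t * centeredKernel μ w t)) = fun t : ℝ =>
      (F * F' - (w - z) * F) * (1 / (z - t)) - (F * F' + (w - z) * F') * (1 / (w - t))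
        + (w - z) := by
    ext t
    have := sub_ofReal_ne_zero hz t
    have := sub_ofReal_ne_zero hw t
    rw [centeredKernel, centeredKernel, ← hF, ← hF']
    field_simp
    ring
  rw [h1, integral_add (by fun_prop) (by fun_prop), integral_sub (by fun_prop) (by fun_prop),
    integral_const_mul, integral_const_mul, ← cauchyTransform, ← cauchyTransform, cauchyDefect,
    cauchyDefect, hF, hF']
  simp
  field_simp
  ring

lemma IsStandardized.norm_cauchyDefect_sub_le [IsProbabilityMeasure μ]
    (h : IsStandardized μ) {z w : ℂ} (hz : z.im ≠ 0) (hw : w.im ≠ 0) :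
    ‖cauchyDefect μ z - cauchyDefect μ w‖ ≤ 1 / (|z.im| * |w.im|) * ‖z - w‖ := by
  have h1 := norm_integral_mul_sq_le (memLp_centeredKernel (μ := μ) hz)
    (memLp_centeredKernel (μ := μ) hw)
  have h2 : ‖∫ t : ℝ, centeredKernel μ z t * centeredKernel μ w t ∂μ‖ ≤ 1 / (|z.im| * |w.im|) := by
    refine le_of_sq_le_sq ?_ (by positivity)
    calc _ ≤ _ := h1
      _ ≤ (1 / |z.im|) ^ 2 * (1 / |w.im|) ^ 2 := by
        gcongr
        · exact h.integral_norm_centeredKernel_sq_le hz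
        · exact h.integral_norm_centeredKernel_sq_le hw
      _ = _ := by rw [← mul_pow, one_div_mul_one_div]
  rw [cauchyDefect_sub hz hw, norm_mul, norm_sub_rev w z, mul_comm]
  gcongr

end

/-! ### The right inverse of the reciprocal Cauchy transform -/

section

variable {μ : Measure ℝ}

lemma ne_zero_of_one_lt_abs {x : ℝ} (hx : 1 < |x|) : x ≠ 0 :=
  abs_pos.1 (one_pos.trans hx)

lemma abs_im_sub_le_of_mem_closedBall {z w : ℂ} {r : ℝ} (h : z ∈ Metric.closedBall w r) :
    |w.im| - r ≤ |z.im| := by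
  rw [mem_closedBall_iff_norm] at h
  have h1 := (Complex.abs_im_le_norm (z - w)).trans h
  rw [Complex.sub_im, abs_sub_comm] at h1
  linarith [abs_sub_abs_le_abs_sub w.im z.im]

/-- Banach's fixed point theorem: on the disc `|Im z| ≥ |Im w| - 1 > 1`, so `|D| < 1` and `D` has
Lipschitz constant below `1`. -/
lemma IsStandardized.exists_cauchyDefect_add_eq [IsProbabilityMeasure μ]
    (h : IsStandardized μ) {w : ℂ} (hw : 2 < |w.im|) :
    ∃ z ∈ Metric.closedBall w 1, w + cauchyDefect μ z = z := by
  have him : ∀ z ∈ Metric.closedBall w 1, |w.im| - 1 ≤ |z.im| :=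
    fun z hz => abs_im_sub_le_of_mem_closedBall hz
  have hne : ∀ z ∈ Metric.closedBall w 1, z.im ≠ 0 := fun z hz =>
    ne_zero_of_one_lt_abs (by linarith [him z hz])
  have hmaps : MapsTo (fun z => w + cauchyDefect μ z) (Metric.closedBall w 1)
      (Metric.closedBall w 1) := by
    intro z hz
    rw [mem_closedBall_iff_norm, add_sub_cancel_left]
    refine (h.norm_cauchyDefect_le (hne z hz)).trans ?_
    rw [div_le_one (abs_pos.2 (hne z hz))]
    linarith [him z hz]
  have ha : 0 < |w.im| - 1 := by linarith
  have hcontr : ContractingWith (1 / ((|w.im| - 1) * (|w.im| - 1))).toNNReal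
      (hmaps.restrict (fun z => w + cauchyDefect μ z) _ _) := by
    refine ⟨?_, LipschitzWith.of_dist_le_mul ?_⟩
    · rw [Real.toNNReal_lt_one, div_lt_one (by positivity)]
      nlinarith
    · rintro ⟨x, hx⟩ ⟨y, hy⟩
      simp only [Subtype.dist_eq, MapsTo.val_restrict_apply, dist_add_left]
      rw [Real.coe_toNNReal _ (by positivity), dist_eq_norm, dist_eq_norm]
      refine (h.norm_cauchyDefect_sub_le (hne x hx) (hne y hy)).trans ?_
      gcongr
      · exact him x hx
      · exact him y hy
  obtain ⟨z, hz, hfix, -⟩ := hcontr.exists_fixedPoint' Metric.isClosed_closedBall.isComplete hmaps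
    (Metric.mem_closedBall_self zero_le_one) (edist_ne_top _ _)
  exact ⟨z, hz, hfix⟩

open Classical in
/-- The right inverse of `1 / G_μ` on `{w | 2 < |Im w|}`. -/
def cauchyRecipInv (μ : Measure ℝ) (w : ℂ) : ℂ :=
  if h : ∃ z ∈ Metric.closedBall w 1, w + cauchyDefect μ z = z then h.choose else 0

lemma IsStandardized.cauchyRecipInv_mem [IsProbabilityMeasure μ]
    (h : IsStandardized μ) {w : ℂ} (hw : 2 < |w.im|) :
    cauchyRecipInv μ w ∈ Metric.closedBall w 1 := by
  rw [cauchyRecipInv, dif_pos (h.exists_cauchyDefect_add_eq hw)]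
  exact (h.exists_cauchyDefect_add_eq hw).choose_spec.1

lemma IsStandardized.add_cauchyDefect_cauchyRecipInv [IsProbabilityMeasure μ]
    (h : IsStandardized μ) {w : ℂ} (hw : 2 < |w.im|) :
    w + cauchyDefect μ (cauchyRecipInv μ w) = cauchyRecipInv μ w := by
  rw [cauchyRecipInv, dif_pos (h.exists_cauchyDefect_add_eq hw)]
  exact (h.exists_cauchyDefect_add_eq hw).choose_spec.2

lemma IsStandardized.abs_im_sub_one_le_cauchyRecipInv [IsProbabilityMeasure μ]
    (h : IsStandardized μ) {w : ℂ} (hw : 2 < |w.im|) :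
    |w.im| - 1 ≤ |(cauchyRecipInv μ w).im| :=
  abs_im_sub_le_of_mem_closedBall (h.cauchyRecipInv_mem hw)

lemma IsStandardized.one_lt_abs_im_cauchyRecipInv [IsProbabilityMeasure μ]
    (h : IsStandardized μ) {w : ℂ} (hw : 2 < |w.im|) : 1 < |(cauchyRecipInv μ w).im| := by
  linarith [h.abs_im_sub_one_le_cauchyRecipInv hw]

lemma IsStandardized.cauchyTransform_cauchyRecipInv [IsProbabilityMeasure μ]
    (h : IsStandardized μ) {w : ℂ} (hw : 2 < |w.im|) :
    cauchyTransform μ (cauchyRecipInv μ w) = 1 / w := by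
  have h1 := h.add_cauchyDefect_cauchyRecipInv hw
  rw [cauchyDefect, ← add_sub_assoc, add_comm, add_sub_assoc, add_eq_left, sub_eq_zero] at h1
  rw [one_div] at h1 ⊢
  exact inv_eq_iff_eq_inv.1 h1.symm

/-- Yields both injectivity of `F` on `|Im z| > 1` and continuity of its inverse; the factor depends
on `z` alone, so `z` can stay fixed while `z'` varies. -/
lemma IsStandardized.norm_sub_mul_le [IsProbabilityMeasure μ] (h : IsStandardized μ)
    {z z' : ℂ} (hz : 1 < |z.im|) (hz' : 1 < |z'.im|) :
    ‖z - z'‖ * (1 - 1 / |z.im|) ≤ ‖(z - cauchyDefect μ z) - (z' - cauchyDefect μ z')‖ := by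
  have h1 := h.norm_cauchyDefect_sub_le (ne_zero_of_one_lt_abs hz) (ne_zero_of_one_lt_abs hz')
  have h2 : 1 / (|z.im| * |z'.im|) ≤ 1 / |z.im| :=
    one_div_le_one_div_of_le (by positivity) (by nlinarith)
  have h3 := norm_sub_norm_le (z - z') (cauchyDefect μ z - cauchyDefect μ z')
  have h4 : (z - cauchyDefect μ z) - (z' - cauchyDefect μ z')
      = z - z' - (cauchyDefect μ z - cauchyDefect μ z') := by ring
  rw [h4]
  have h5 := mul_le_mul_of_nonneg_right h2 (norm_nonneg (z - z'))
  linarith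

lemma IsStandardized.eq_of_sub_cauchyDefect_eq [IsProbabilityMeasure μ] (h : IsStandardized μ)
    {z z' : ℂ} (hz : 1 < |z.im|) (hz' : 1 < |z'.im|)
    (heq : z - cauchyDefect μ z = z' - cauchyDefect μ z') : z = z' := by
  have h1 := h.norm_sub_mul_le hz hz'
  rw [heq, sub_self, norm_zero] at h1
  have h2 : 0 < 1 - 1 / |z.im| := by
    rw [sub_pos, div_lt_one (by linarith)]
    exact hz
  exact sub_eq_zero.1 (norm_le_zero_iff.1 (nonpos_of_mul_nonpos_left h1 h2))

lemma IsStandardized.cauchyRecipInv_sub_cauchyDefect [IsProbabilityMeasure μ]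
    (h : IsStandardized μ) {w : ℂ} (hw : 2 < |w.im|) :
    cauchyRecipInv μ w - cauchyDefect μ (cauchyRecipInv μ w) = w := by
  rw [sub_eq_iff_eq_add, h.add_cauchyDefect_cauchyRecipInv hw]

lemma IsStandardized.eq_cauchyRecipInv [IsProbabilityMeasure μ] (h : IsStandardized μ)
    {z w : ℂ} (hw : 2 < |w.im|) (hz : 1 < |z.im|) (heq : cauchyTransform μ z = 1 / w) :
    z = cauchyRecipInv μ w := by
  refine h.eq_of_sub_cauchyDefect_eq hz (h.one_lt_abs_im_cauchyRecipInv hw) ?_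
  rw [h.cauchyRecipInv_sub_cauchyDefect hw, cauchyDefect, heq, one_div_one_div, sub_sub_cancel]

lemma isOpen_two_lt_abs_im : IsOpen {w : ℂ | 2 < |w.im|} :=
  isOpen_lt continuous_const (Complex.continuous_im.abs)

lemma IsStandardized.continuousAt_cauchyRecipInv [IsProbabilityMeasure μ]
    (h : IsStandardized μ) {w : ℂ} (hw : 2 < |w.im|) : ContinuousAt (cauchyRecipInv μ) w := by
  have hb := h.one_lt_abs_im_cauchyRecipInv hw
  have hc : 0 < 1 - 1 / |(cauchyRecipInv μ w).im| := by
    rw [sub_pos, div_lt_one (by linarith)]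
    exact hb
  rw [ContinuousAt, tendsto_iff_norm_sub_tendsto_zero]
  have hlim : Tendsto (fun v : ℂ => ‖w - v‖ / (1 - 1 / |(cauchyRecipInv μ w).im|)) (𝓝 w) (𝓝 0) := by
    have : Continuous fun v : ℂ => ‖w - v‖ / (1 - 1 / |(cauchyRecipInv μ w).im|) := by fun_prop
    simpa using this.tendsto w
  refine squeeze_zero' (Eventually.of_forall fun _ => norm_nonneg _) ?_ hlim
  filter_upwards [isOpen_two_lt_abs_im.mem_nhds hw] with v hv
  have h1 := h.norm_sub_mul_le hb (h.one_lt_abs_im_cauchyRecipInv hv)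
  rw [h.cauchyRecipInv_sub_cauchyDefect hw, h.cauchyRecipInv_sub_cauchyDefect hv] at h1
  rwa [le_div_iff₀ hc, norm_sub_rev]

lemma IsStandardized.norm_deriv_cauchyDefect_lt_one [IsProbabilityMeasure μ]
    (h : IsStandardized μ) {z : ℂ} (hz : 1 < |z.im|) : ‖deriv (cauchyDefect μ) z‖ < 1 := by
  refine lt_of_le_of_lt (norm_deriv_le_of_lip' (C := 1 / |z.im|) (by positivity) ?_) ?_
  · have : IsOpen {w : ℂ | 1 < |w.im|} := isOpen_lt continuous_const (Complex.continuous_im.abs)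
    filter_upwards [this.mem_nhds hz] with w hw
    have h1 := h.norm_cauchyDefect_sub_le (ne_zero_of_one_lt_abs hw) (ne_zero_of_one_lt_abs hz)
    refine h1.trans ?_
    have hw' : 1 < |w.im| := hw
    gcongr
    nlinarith
  · rwa [div_lt_one (by linarith)]

/-- A continuous right inverse of `F` is differentiable wherever `F' = 1 - D'` is nonzero, and `|D'|
< 1`. -/
lemma IsStandardized.differentiableAt_cauchyRecipInv [IsProbabilityMeasure μ]
    (h : IsStandardized μ) {w : ℂ} (hw : 2 < |w.im|) :
    DifferentiableAt ℂ (cauchyRecipInv μ) w := by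
  have hb := h.one_lt_abs_im_cauchyRecipInv hw
  have hd := (differentiableAt_cauchyDefect (μ := μ) (ne_zero_of_one_lt_abs hb)).hasDerivAt
  refine (HasDerivAt.of_local_left_inverse (h.continuousAt_cauchyRecipInv hw)
    ((hasDerivAt_id _).sub hd) ?_ ?_).differentiableAt
  · intro h0
    have h1 := h.norm_deriv_cauchyDefect_lt_one hb
    rw [← sub_eq_zero.1 h0, norm_one] at h1
    exact lt_irrefl _ h1
  · filter_upwards [isOpen_two_lt_abs_im.mem_nhds hw] with v hv
    exact h.cauchyRecipInv_sub_cauchyDefect hv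

/-! ### Existence and uniqueness of the R-transform -/

/-- In this form membership reads off directly as `|Im (1/z)| > 2`. -/
lemma mem_rDomain_iff {z : ℂ} : z ∈ rDomain ↔ 2 * ‖z‖ ^ 2 < |z.im| := by
  have key : ∀ s : ℝ, ‖z - s * (Complex.I / 4)‖ ^ 2 = ‖z‖ ^ 2 - s * z.im / 2 + s ^ 2 / 16 := by
    intro s
    rw [← Complex.normSq_eq_norm_sq, ← Complex.normSq_eq_norm_sq, Complex.normSq_apply,
      Complex.normSq_apply]
    simp
    ring
  have h1 : ∀ c : ℂ, z ∈ Metric.ball c (1 / 4) ↔ ‖z - c‖ ^ 2 < (1 / 4) ^ 2 := by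
    intro c
    rw [mem_ball_iff_norm, sq_lt_sq₀ (norm_nonneg _) (by norm_num)]
  have h2 := key (-1)
  have h3 := key 1
  rw [rDomain, mem_union, h1, h1, lt_abs]
  norm_num at h2 h3
  rw [sub_neg_eq_add, h2, h3]
  constructor
  · rintro (h | h)
    · right; linarith
    · left; linarith
  · rintro (h | h)
    · right; linarith
    · left; linarith

lemma isOpen_rDomain : IsOpen rDomain := Metric.isOpen_ball.union Metric.isOpen_ball

lemma ne_zero_of_mem_rDomain {z : ℂ} (hz : z ∈ rDomain) : z ≠ 0 := by
  rintro rfl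
  simp [mem_rDomain_iff] at hz

lemma two_lt_abs_im_one_div {z : ℂ} (hz : z ∈ rDomain) : 2 < |(1 / z).im| := by
  have h0 := ne_zero_of_mem_rDomain hz
  have hpos : 0 < ‖z‖ := norm_pos_iff.2 h0
  rw [one_div, Complex.inv_im, Complex.normSq_eq_norm_sq, abs_div, abs_neg, abs_of_nonneg
    (sq_nonneg ‖z‖), lt_div_iff₀ (by positivity)]
  exact mem_rDomain_iff.1 hz

lemma ofReal_mul_I_mem_rDomain {y : ℝ} (h0 : y ≠ 0) (hy : |y| < 1 / 2) :
    (y * Complex.I : ℂ) ∈ rDomain := by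
  have : 0 < |y| := abs_pos.2 h0
  rw [mem_rDomain_iff]
  simp
  nlinarith [sq_abs y]

lemma abs_im_one_div_ofReal_mul_I (y : ℝ) : |(1 / (y * Complex.I : ℂ)).im| = 1 / |y| := by
  rcases eq_or_ne y 0 with rfl | h0
  · simp
  have hpos : 0 < |y| := abs_pos.2 h0
  rw [one_div, Complex.inv_im]
  simp [Complex.normSq_apply, abs_div]
  field_simp
  exact sq_abs y

lemma eventually_ne_zero_and_abs_lt : ∀ᶠ y : ℝ in 𝓝[≠] 0, y ≠ 0 ∧ |y| < 1 / 2 := by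
  have h1 : ∀ᶠ y : ℝ in 𝓝 0, |y| < 1 / 2 :=
    (continuous_abs.tendsto' (0 : ℝ) 0 abs_zero).eventually_lt_const (by norm_num)
  exact eventually_mem_nhdsWithin.and (h1.filter_mono nhdsWithin_le_nhds)

lemma eventually_ofReal_mul_I_mem_rDomain :
    ∀ᶠ y : ℝ in 𝓝[≠] 0, (y * Complex.I : ℂ) ∈ rDomain :=
  eventually_ne_zero_and_abs_lt.mono fun _ hy => ofReal_mul_I_mem_rDomain hy.1 hy.2

lemma IsStandardized.norm_cauchyRecipInv_sub_le [IsProbabilityMeasure μ]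
    (h : IsStandardized μ) {w : ℂ} (hw : 2 < |w.im|) :
    ‖cauchyRecipInv μ w - w‖ ≤ 1 / (|w.im| - 1) := by
  have h1 := h.add_cauchyDefect_cauchyRecipInv hw
  have h2 := h.one_lt_abs_im_cauchyRecipInv hw
  rw [← eq_sub_iff_add_eq'] at h1
  rw [← h1]
  refine (h.norm_cauchyDefect_le (ne_zero_of_one_lt_abs h2)).trans ?_
  exact one_div_le_one_div_of_le (by linarith) (h.abs_im_sub_one_le_cauchyRecipInv hw)

lemma IsStandardized.isRTransform [IsProbabilityMeasure μ] (h : IsStandardized μ) :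
    IsRTransform μ fun z => cauchyRecipInv μ (1 / z) - 1 / z where
  analytic := by
    refine DifferentiableOn.analyticOnNhd (fun z hz => ?_) isOpen_rDomain
    have h1 : DifferentiableAt ℂ (fun z : ℂ => 1 / z) z :=
      (differentiableAt_const _).div differentiableAt_id (ne_zero_of_mem_rDomain hz)
    exact (((h.differentiableAt_cauchyRecipInv (two_lt_abs_im_one_div hz)).comp z h1).sub
      h1).differentiableWithinAt
  im_ne_zero z hz := by
    rw [sub_add_cancel]
    exact ne_zero_of_one_lt_abs (h.one_lt_abs_im_cauchyRecipInv (two_lt_abs_im_one_div hz))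
  cauchy_eq z hz := by
    rw [sub_add_cancel, h.cauchyTransform_cauchyRecipInv (two_lt_abs_im_one_div hz),
      one_div_one_div]
  branch := by
    have hlim : Tendsto (fun y : ℝ => |y|) (𝓝[≠] 0) (𝓝 0) :=
      (continuous_abs.tendsto' (0 : ℝ) 0 abs_zero).mono_left nhdsWithin_le_nhds
    refine squeeze_zero_norm' ?_ hlim
    filter_upwards [eventually_ofReal_mul_I_mem_rDomain] with y hy
    have h2 := two_lt_abs_im_one_div hy
    have h1 := h.norm_cauchyRecipInv_sub_le h2
    rw [norm_mul]
    calc _ ≤ |y| * 1 := by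
          gcongr
          · simp
          · exact h1.trans ((div_le_one (by linarith)).2 (by linarith))
      _ = _ := mul_one _

/-- Once `|z R(z)| < 1/2` at `z = iy`, the point `R(z) + 1/z` has `|Im| > 1/(2|y|) > 1`, where `F`
is injective. -/
lemma IsRTransform.eventually_eq [IsProbabilityMeasure μ] (h : IsStandardized μ) {R : ℂ → ℂ}
    (hR : IsRTransform μ R) : ∀ᶠ y : ℝ in 𝓝[≠] 0,
      R (y * Complex.I) = cauchyRecipInv μ (1 / (y * Complex.I)) - 1 / (y * Complex.I) := by
  have h2 : ∀ᶠ y : ℝ in 𝓝[≠] 0, ‖(y * Complex.I) * R (y * Complex.I)‖ < 1 / 2 :=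
    hR.branch.norm.eventually_lt_const (by norm_num)
  filter_upwards [eventually_ne_zero_and_abs_lt, h2] with y ⟨h0, hy1⟩ hy2
  have hy := ofReal_mul_I_mem_rDomain h0 hy1
  rw [eq_sub_iff_add_eq]
  refine h.eq_cauchyRecipInv (two_lt_abs_im_one_div hy) ?_
    (by rw [hR.cauchy_eq _ hy, one_div_one_div])
  have hpos : 0 < |y| := abs_pos.2 h0
  have h4 : ‖R (y * Complex.I)‖ < 1 / 2 / |y| := by
    rw [norm_mul] at hy2
    rw [lt_div_iff₀ hpos, mul_comm]
    simpa using hy2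
  have h5 := Complex.abs_im_le_norm (R (y * Complex.I))
  have h6 := abs_sub_abs_le_abs_sub (1 / (y * Complex.I : ℂ)).im (-(R (y * Complex.I)).im)
  rw [abs_neg, sub_neg_eq_add, abs_im_one_div_ofReal_mul_I] at h6
  have h7 : 1 < 1 / 2 / |y| := by rwa [lt_div_iff₀ hpos, one_mul]
  have h8 : 1 / |y| = 1 / 2 / |y| + 1 / 2 / |y| := by ring
  rw [Complex.add_im, add_comm]
  linarith

/-- The identity theorem along a real curve. -/
lemma AnalyticOnNhd.eqOn_of_eventually_eq_comp {f g : ℂ → ℂ} {U : Set ℂ}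
    (hf : AnalyticOnNhd ℂ f U) (hg : AnalyticOnNhd ℂ g U) (hU : IsPreconnected U) {c : ℝ → ℂ}
    {y₀ : ℝ} {z₀ : ℂ} (hz₀ : z₀ ∈ U) (hc : Tendsto c (𝓝[≠] y₀) (𝓝[≠] z₀))
    (h : ∀ᶠ y in 𝓝[≠] y₀, f (c y) = g (c y)) : EqOn f g U :=
  hf.eqOn_of_preconnected_of_frequently_eq hg hU hz₀ (hc.frequently h.frequently)

lemma tendsto_ofReal_mul_I_nhdsNE (y₀ : ℝ) :
    Tendsto (fun y : ℝ => (y * Complex.I : ℂ)) (𝓝[≠] y₀) (𝓝[≠] (y₀ * Complex.I)) := by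
  have hinj : Function.Injective fun y : ℝ => (y * Complex.I : ℂ) := fun a b hab => by
    simpa using hab
  exact (Continuous.continuousAt (by fun_prop)).continuousWithinAt.tendsto_nhdsWithin
    fun y hy => hinj.ne hy

lemma IsRTransform.eqOn [IsProbabilityMeasure μ] (h : IsStandardized μ) {R R' : ℂ → ℂ}
    (hR : IsRTransform μ R) (hR' : IsRTransform μ R') : EqOn R R' rDomain := by
  have h1 : ∀ᶠ y : ℝ in 𝓝[≠] 0, R (y * Complex.I) = R' (y * Complex.I) := by
    filter_upwards [hR.eventually_eq h, hR'.eventually_eq h] with y hy hy'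
    rw [hy, hy']
  rw [eventually_nhdsWithin_iff, Metric.eventually_nhds_iff] at h1
  obtain ⟨ε, hε, h1⟩ := h1
  -- The origin lies outside `rDomain`, and the two discs are disjoint, so the identity theorem is
  -- applied in each disc at `±iδ`: inside the disc as `δ ≤ 1/4`, inside the range of agreement as
  -- `δ < ε`.
  set δ := min (ε / 2) (1 / 4) with hδ
  have hδ0 : 0 < δ := by positivity
  have hδ1 : δ ≤ 1 / 4 := min_le_right _ _
  have hδ2 : δ < ε := (min_le_left _ _).trans_lt (by linarith)
  have key : ∀ s : ℝ, s = 1 ∨ s = -1 →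
      EqOn R R' (Metric.ball (s * (Complex.I / 4)) (1 / 4)) := by
    intro s hs
    have hsub : Metric.ball (s * (Complex.I / 4)) (1 / 4) ⊆ rDomain := by
      rcases hs with rfl | rfl
      · exact fun z hz => Or.inr (by simpa using hz)
      · exact fun z hz => Or.inl (by simpa using hz)
    have habs : |s| = 1 := by rcases hs with rfl | rfl <;> simp
    have hs0 : s * δ ≠ 0 := by rcases hs with rfl | rfl <;> simp [hδ0.ne']
    refine (hR.analytic.mono hsub).eqOn_of_eventually_eq_comp (hR'.analytic.mono hsub)
      (convex_ball _ _).isPreconnected (y₀ := s * δ) ?_ (tendsto_ofReal_mul_I_nhdsNE _) ?_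
    · rw [mem_ball_iff_norm]
      have : (((s * δ : ℝ) : ℂ) * Complex.I - s * (Complex.I / 4))
          = ((s * (δ - 1 / 4) : ℝ) : ℂ) * Complex.I := by push_cast; ring
      rw [this, norm_mul, Complex.norm_I, Complex.norm_real, Real.norm_eq_abs, abs_mul, habs,
        one_mul, mul_one, abs_lt]
      constructor <;> linarith
    · refine Eventually.filter_mono nhdsWithin_le_nhds ?_
      have hlt : |s * δ| < ε := by rwa [abs_mul, habs, one_mul, abs_of_pos hδ0]
      filter_upwards [isOpen_ne.mem_nhds hs0, (isOpen_lt continuous_abs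
        continuous_const).mem_nhds hlt] with y hy0 hy
      exact h1 (by simpa using hy) hy0
  intro z hz
  rcases hz with hz | hz
  · exact key (-1) (Or.inr rfl) (by simpa using hz)
  · exact key 1 (Or.inl rfl) (by simpa using hz)

end

/-! ### The expansion of the R-transform at the origin -/

section

variable {μ : Measure ℝ}

/-- The integrand of the second order remainder of the R-transform. -/
def rRemainderKernel (μ : Measure ℝ) (z : ℂ) (t : ℝ) : ℂ :=
  t * (t - (cauchyRecipInv μ (1 / z) - 1 / z)) ^ 2 / (z * (cauchyRecipInv μ (1 / z) - t))

/-- With `u = z (t - R)` one has `z (ζ - t) = 1 - u`, so `k_ζ = 1/(1 - u) - 1 = u + u²/(1 - u)`.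
Against `t`, the linear term integrates to `z` because the mean is `0` and the variance `1`. -/
lemma IsStandardized.rTransform_sub_eq [IsProbabilityMeasure μ] (h : IsStandardized μ) {z : ℂ}
    (hz : z ∈ rDomain) :
    cauchyRecipInv μ (1 / z) - 1 / z - z = z ^ 2 * ∫ t : ℝ, rRemainderKernel μ z t ∂μ := by
  have hw := two_lt_abs_im_one_div hz
  have hz0 := ne_zero_of_mem_rDomain hz
  have hζ := ne_zero_of_one_lt_abs (h.one_lt_abs_im_cauchyRecipInv hw)
  have hG : cauchyTransform μ (cauchyRecipInv μ (1 / z)) = z := by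
    rw [h.cauchyTransform_cauchyRecipInv hw, one_div_one_div]
  have hR : cauchyDefect μ (cauchyRecipInv μ (1 / z)) = cauchyRecipInv μ (1 / z) - 1 / z := by
    rw [cauchyDefect, hG]
  have hi1 : Integrable (fun t : ℝ =>
      (t : ℂ) * centeredKernel μ (cauchyRecipInv μ (1 / z)) t) μ :=
    h.memLp_ofReal.integrable_mul (memLp_centeredKernel hζ)
  have hi2 : Integrable (fun t : ℝ => ((t ^ 2 : ℝ) : ℂ)) μ := h.memLp.integrable_sq.ofReal
  have hi3 : Integrable (fun t : ℝ => (t : ℂ)) μ := h.memLp_ofReal.integrable one_le_two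
  rw [← integral_const_mul]
  have h1 : (fun t : ℝ => z ^ 2 * rRemainderKernel μ z t) = fun t : ℝ =>
      (t : ℂ) * centeredKernel μ (cauchyRecipInv μ (1 / z)) t - z * ((t ^ 2 : ℝ) : ℂ)
        + z * (cauchyRecipInv μ (1 / z) - 1 / z) * t := by
    ext t
    have := sub_ofReal_ne_zero hζ t
    rw [rRemainderKernel, centeredKernel, hG]
    push_cast
    generalize cauchyRecipInv μ (1 / z) = ζ at *
    field_simp
    ring
  rw [h1, integral_add (by fun_prop) (by fun_prop), integral_sub (by fun_prop) (by fun_prop),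
    integral_const_mul, integral_const_mul, h.integral_mul_centeredKernel hζ,
    h.integral_ofReal_eq_zero, integral_complex_ofReal, h.variance, hR]
  simp

lemma IsStandardized.norm_rTransform_le [IsProbabilityMeasure μ] (h : IsStandardized μ) {y : ℝ}
    (h0 : y ≠ 0) (hy : |y| < 1 / 2) :
    ‖cauchyRecipInv μ (1 / (y * Complex.I)) - 1 / (y * Complex.I)‖ ≤ 2 * |y| := by
  have hpos : 0 < |y| := abs_pos.2 h0
  refine (h.norm_cauchyRecipInv_sub_le
    (two_lt_abs_im_one_div (ofReal_mul_I_mem_rDomain h0 hy))).trans ?_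
  have h1 : 1 / |y| - 1 = (1 - |y|) / |y| := by field_simp
  rw [abs_im_one_div_ofReal_mul_I, h1, one_div_div, div_le_iff₀ (by linarith)]
  nlinarith

lemma IsStandardized.norm_rRemainderKernel_le [IsProbabilityMeasure μ] (h : IsStandardized μ)
    {y : ℝ} (h0 : y ≠ 0) (hy : |y| < 1 / 2) (t : ℝ) :
    ‖rRemainderKernel μ (y * Complex.I) t‖ ≤ 2 * (|t| ^ 3 + 2 * t ^ 2 + |t|) := by
  have hpos : 0 < |y| := abs_pos.2 h0
  have hw := two_lt_abs_im_one_div (ofReal_mul_I_mem_rDomain h0 hy)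
  have hR := h.norm_rTransform_le h0 hy
  -- `|Im ζ| ≥ 1/|y| - 1`, so the denominator is at least `1 - |y| > 1/2`, uniformly in `t`.
  have h1 : 1 / 2 ≤ ‖y * Complex.I * (cauchyRecipInv μ (1 / (y * Complex.I)) - t)‖ := by
    have h2 := (h.abs_im_sub_one_le_cauchyRecipInv hw).trans
      (abs_im_le_norm_sub_ofReal (cauchyRecipInv μ (1 / (y * Complex.I))) t)
    rw [abs_im_one_div_ofReal_mul_I] at h2
    rw [norm_mul, norm_mul, Complex.norm_I, Complex.norm_real, mul_one, Real.norm_eq_abs]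
    calc 1 / 2 ≤ |y| * (1 / |y| - 1) := by rw [mul_sub, mul_one_div_cancel hpos.ne']; linarith
      _ ≤ _ := by gcongr
  have h2 : ‖(t : ℂ) - (cauchyRecipInv μ (1 / (y * Complex.I)) - 1 / (y * Complex.I))‖
      ≤ |t| + 1 := by
    refine (norm_sub_le _ _).trans ?_
    rw [Complex.norm_real, Real.norm_eq_abs]
    linarith
  rw [rRemainderKernel, norm_div, norm_mul, norm_pow, Complex.norm_real, Real.norm_eq_abs]
  calc _ ≤ |t| * (|t| + 1) ^ 2 / (1 / 2) := by gcongr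
    _ = _ := by
      rw [← sq_abs t]
      ring

lemma IsStandardized.integrable_bound [IsProbabilityMeasure μ] (h : IsStandardized μ)
    (h3 : Integrable (fun x : ℝ => |x| ^ 3) μ) :
    Integrable (fun t : ℝ => 2 * (|t| ^ 3 + 2 * t ^ 2 + |t|)) μ :=
  (((h3.add (h.memLp.integrable_sq.const_mul 2)).add
    (h.memLp.integrable one_le_two).abs).const_mul 2)

lemma IsStandardized.norm_rTransform_sub_le [IsProbabilityMeasure μ] (h : IsStandardized μ)
    (h3 : Integrable (fun x : ℝ => |x| ^ 3) μ) {y : ℝ} (h0 : y ≠ 0) (hy : |y| < 1 / 2) :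
    ‖cauchyRecipInv μ (1 / (y * Complex.I)) - 1 / (y * Complex.I) - y * Complex.I‖
      ≤ y ^ 2 * ∫ t : ℝ, 2 * (|t| ^ 3 + 2 * t ^ 2 + |t|) ∂μ := by
  rw [h.rTransform_sub_eq (ofReal_mul_I_mem_rDomain h0 hy), norm_mul, norm_pow, norm_mul,
    Complex.norm_I, Complex.norm_real, mul_one, Real.norm_eq_abs, sq_abs]
  gcongr
  exact norm_integral_le_of_norm_le (h.integrable_bound h3)
    (Eventually.of_forall (h.norm_rRemainderKernel_le h0 hy))

lemma IsStandardized.tendsto_rTransform_zero [IsProbabilityMeasure μ] (h : IsStandardized μ) :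
    Tendsto (fun y : ℝ => cauchyRecipInv μ (1 / (y * Complex.I)) - 1 / (y * Complex.I))
      (𝓝[≠] 0) (𝓝 0) := by
  have hlim : Tendsto (fun y : ℝ => 2 * |y|) (𝓝[≠] 0) (𝓝 0) :=
    (Continuous.tendsto' (by fun_prop) (0 : ℝ) 0 (by simp)).mono_left nhdsWithin_le_nhds
  refine squeeze_zero_norm' ?_ hlim
  filter_upwards [eventually_ne_zero_and_abs_lt] with y hy using h.norm_rTransform_le hy.1 hy.2

lemma IsStandardized.tendsto_integral_rRemainderKernel [IsProbabilityMeasure μ]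
    (h : IsStandardized μ) (h3 : Integrable (fun x : ℝ => |x| ^ 3) μ) :
    Tendsto (fun y : ℝ => ∫ t : ℝ, rRemainderKernel μ (y * Complex.I) t ∂μ) (𝓝[≠] 0)
      (𝓝 ((∫ x : ℝ, x ^ 3 ∂μ : ℝ) : ℂ)) := by
  rw [← integral_complex_ofReal]
  refine tendsto_integral_filter_of_dominated_convergence _ ?_ ?_ (h.integrable_bound h3) ?_
  · refine Eventually.of_forall fun y => Measurable.aestronglyMeasurable ?_
    unfold rRemainderKernel
    fun_prop
  · filter_upwards [eventually_ne_zero_and_abs_lt] with y hy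
    exact Eventually.of_forall (h.norm_rRemainderKernel_le hy.1 hy.2)
  · refine Eventually.of_forall fun t => ?_
    have hR := h.tendsto_rTransform_zero
    have hy : Tendsto (fun y : ℝ => (y * Complex.I : ℂ)) (𝓝[≠] 0) (𝓝 0) :=
      (Continuous.tendsto' (by fun_prop) (0 : ℝ) 0 (by simp)).mono_left nhdsWithin_le_nhds
    -- The denominator `z (ζ - t)` is rewritten as `1 + z R - z t`, so that it visibly tends to `1`.
    have hlim := ((tendsto_const_nhds (x := (t : ℂ))).mul
      (((tendsto_const_nhds (x := (t : ℂ))).sub hR).pow 2)).div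
      (((hy.mul hR).const_add 1).sub (hy.mul_const (t : ℂ))) (by simp)
    have hval : (t : ℂ) * ((t : ℂ) - 0) ^ 2 / (1 + 0 * 0 - 0 * (t : ℂ)) = ((t ^ 3 : ℝ) : ℂ) := by
      push_cast
      ring
    rw [hval] at hlim
    refine hlim.congr' ?_
    filter_upwards [eventually_ne_zero_and_abs_lt] with y hy
    have h0 := ne_zero_of_mem_rDomain (ofReal_mul_I_mem_rDomain hy.1 hy.2)
    rw [rRemainderKernel, Pi.div_apply]
    congr 1
    rw [mul_sub, mul_one_div_cancel h0]
    ring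

lemma IsStandardized.isLittleO_rTransform [IsProbabilityMeasure μ]
    (h : IsStandardized μ) (h3 : Integrable (fun x : ℝ => |x| ^ 3) μ) :
    (fun y : ℝ => cauchyRecipInv μ (1 / (y * Complex.I)) - 1 / (y * Complex.I) -
        ((y * Complex.I) + ((∫ x : ℝ, x ^ 3 ∂μ : ℝ) : ℂ) * (y * Complex.I) ^ 2))
      =o[𝓝[≠] 0] (fun y : ℝ => y ^ 2) := by
  rw [isLittleO_iff]
  intro c hc
  have hlim := (h.tendsto_integral_rRemainderKernel h3).eventually (Metric.closedBall_mem_nhds _ hc)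
  filter_upwards [hlim, eventually_ne_zero_and_abs_lt] with y hy hy0
  rw [dist_eq_norm] at hy
  rw [← sub_sub, h.rTransform_sub_eq (ofReal_mul_I_mem_rDomain hy0.1 hy0.2), mul_comm,
    ← sub_mul, norm_mul, norm_pow, norm_mul, Complex.norm_I, Complex.norm_real, mul_one, norm_pow]
  gcongr

/-! ### The R-transform and the distance on `Q3` -/

lemma isStandardized_of_mem_Q3 (μ : Q3) : IsStandardized (μ.1 : Measure ℝ) where
  memLp := by
    rw [memLp_two_iff_integrable_sq (by fun_prop)]
    -- A non-integrable square would have integral `0` by convention, not `1`.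
    by_contra h
    have := μ.2.2.2
    rw [integral_undef h] at this
    exact zero_ne_one this
  mean := μ.2.2.1
  variance := μ.2.2.2

lemma isRTransform_rTransform (μ : Q3) : IsRTransform (μ.1 : Measure ℝ) (rTransform μ) := by
  have h : ∃ R, IsRTransform (μ.1 : Measure ℝ) R :=
    ⟨_, (isStandardized_of_mem_Q3 μ).isRTransform⟩
  rw [rTransform, dif_pos h]
  exact h.choose_spec

lemma rTransform_eq (μ : Q3) {z : ℂ} (hz : z ∈ rDomain) :
    rTransform μ z = cauchyRecipInv μ.1 (1 / z) - 1 / z :=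
  (isRTransform_rTransform μ).eqOn (isStandardized_of_mem_Q3 μ)
    (isStandardized_of_mem_Q3 μ).isRTransform hz

lemma abs_lt_half_of_mem_Ioc {y : ℝ} (hy : y ∈ Ioc (0 : ℝ) (1 / 4)) : |y| < 1 / 2 := by
  rw [abs_of_pos hy.1]
  linarith [hy.2]

lemma ofReal_mul_I_mem_rDomain_of_mem_Ioc {y : ℝ} (hy : y ∈ Ioc (0 : ℝ) (1 / 4)) :
    (y * Complex.I : ℂ) ∈ rDomain :=
  ofReal_mul_I_mem_rDomain hy.1.ne' (abs_lt_half_of_mem_Ioc hy)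

/-- Both R-transforms have the same leading term `z`, which cancels, leaving two remainders of size
`O(y²)`. -/
lemma rDist_lt_top (μ ν : Q3) : rDist μ ν < ∞ := by
  set C : Q3 → ℝ := fun μ => ∫ t : ℝ, 2 * (|t| ^ 3 + 2 * t ^ 2 + |t|) ∂(μ.1 : Measure ℝ)
  refine lt_of_le_of_lt (iSup₂_le (a := ENNReal.ofReal (C μ + C ν)) fun y hy => ?_)
    ENNReal.ofReal_lt_top
  refine ENNReal.ofReal_le_ofReal ?_
  have h1 : ∀ ξ : Q3, ‖rTransform ξ (y * Complex.I) - y * Complex.I‖ ≤ y ^ 2 * C ξ := by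
    intro ξ
    rw [rTransform_eq ξ (ofReal_mul_I_mem_rDomain_of_mem_Ioc hy)]
    exact (isStandardized_of_mem_Q3 ξ).norm_rTransform_sub_le ξ.2.1 hy.1.ne'
      (abs_lt_half_of_mem_Ioc hy)
  have h2 := norm_sub_le (rTransform μ (y * Complex.I) - y * Complex.I)
    (rTransform ν (y * Complex.I) - y * Complex.I)
  rw [sub_sub_sub_cancel_right] at h2
  rw [div_le_iff₀ (pow_pos hy.1 2)]
  linarith [h1 μ, h1 ν]

lemma rDist_self (μ : Q3) : rDist μ μ = 0 := by simp [rDist]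

lemma rDist_comm (μ ν : Q3) : rDist μ ν = rDist ν μ := by
  simp only [rDist, norm_sub_rev]

lemma rDist_triangle (μ ν ξ : Q3) : rDist μ ξ ≤ rDist μ ν + rDist ν ξ := by
  refine iSup₂_le fun y hy => ?_
  refine le_trans ?_ (add_le_add (le_iSup₂ (f := fun y (_ : y ∈ Ioc (0 : ℝ) (1 / 4)) =>
    ENNReal.ofReal (‖rTransform μ (y * Complex.I) - rTransform ν (y * Complex.I)‖ / y ^ 2)) y hy)
    (le_iSup₂ (f := fun y (_ : y ∈ Ioc (0 : ℝ) (1 / 4)) =>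
    ENNReal.ofReal (‖rTransform ν (y * Complex.I) - rTransform ξ (y * Complex.I)‖ / y ^ 2)) y hy))
  rw [← ENNReal.ofReal_add (by positivity) (by positivity), ← add_div]
  refine ENNReal.ofReal_le_ofReal ?_
  gcongr
  exact norm_sub_le_norm_sub_add_norm_sub _ _ _

end

/-! ### Poisson integrals and uniqueness of the Cauchy transform -/

/-- The Poisson kernel of the half-plane, without the factor `1 / π`. -/
def poissonKer (η x : ℝ) : ℝ := η / (x ^ 2 + η ^ 2)

lemma continuous_poissonKer {η : ℝ} (hη : 0 < η) : Continuous (poissonKer η) :=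
  continuous_const.div (by fun_prop) fun x => by positivity

lemma poissonKer_mul {η : ℝ} (hη : 0 < η) (s : ℝ) :
    poissonKer η (η * s) = η⁻¹ * (1 + s ^ 2)⁻¹ := by
  unfold poissonKer
  field_simp
  ring

lemma integrable_poissonKer {η : ℝ} (hη : 0 < η) : Integrable (poissonKer η) := by
  rw [← integrable_comp_mul_left_iff _ hη.ne']
  simp_rw [poissonKer_mul hη]
  exact integrable_inv_one_add_sq.const_mul _

/-- The substitution `x = t + η s` moves `η` into the argument of `f`, so `η → 0` becomes a
dominated limit against a fixed density. -/
lemma integral_mul_poissonKer {η : ℝ} (hη : 0 < η) (f : ℝ → ℝ) (t : ℝ) :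
    ∫ x, f x * poissonKer η (x - t) = ∫ s, f (t + η * s) * (1 + s ^ 2)⁻¹ := by
  have h1 : ∫ x, f x * poissonKer η (x - t) = ∫ x, f (t + x) * poissonKer η x := by
    rw [← integral_add_left_eq_self _ t]
    simp
  have h2 := Measure.integral_comp_mul_left (fun x => f (t + x) * poissonKer η x) η
  simp_rw [poissonKer_mul hη] at h2
  rw [h1, ← mul_right_inj' (inv_pos.2 hη).ne']
  rw [abs_of_pos (inv_pos.2 hη), smul_eq_mul] at h2
  rw [← h2, ← integral_const_mul]
  congr 1
  ext s
  ring

lemma im_cauchyTransform_lower (μ : Measure ℝ) [IsFiniteMeasure μ] {η : ℝ} (hη : 0 < η) (x : ℝ) :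
    (cauchyTransform μ (x - η * Complex.I)).im = ∫ t, poissonKer η (x - t) ∂μ := by
  have him : ((x : ℂ) - η * Complex.I).im = -η := by simp
  rw [im_cauchyTransform μ (by rw [him]; exact neg_ne_zero.2 hη.ne'), him, neg_neg,
    ← integral_const_mul]
  congr 1
  ext t
  rw [norm_div, norm_one, div_pow, one_pow, ← Complex.normSq_eq_norm_sq, Complex.normSq_apply,
    poissonKer]
  simp
  field_simp

lemma integrable_poissonKer_sub (μ : Measure ℝ) [IsFiniteMeasure μ] {η : ℝ} (hη : 0 < η) :
    Integrable (fun p : ℝ × ℝ => poissonKer η (p.1 - p.2)) (volume.prod μ) := by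
  have hc := continuous_poissonKer hη
  rw [integrable_prod_iff' (Continuous.aestronglyMeasurable (by fun_prop))]
  refine ⟨Eventually.of_forall fun t => (integrable_poissonKer hη).comp_sub_right t, ?_⟩
  have h : ∀ t : ℝ, ∫ x, ‖poissonKer η (x - t)‖ = ∫ x, ‖poissonKer η x‖ := fun t =>
    integral_sub_right_eq_self (fun x => ‖poissonKer η x‖) t
  simp only [h]
  exact integrable_const _

lemma integrable_mul_inv_one_add_sq (μ : Measure ℝ) [IsFiniteMeasure μ] (f : ℝ →ᵇ ℝ) (η : ℝ) :
    Integrable (fun p : ℝ × ℝ => f (p.1 + η * p.2) * (1 + p.2 ^ 2)⁻¹) (μ.prod volume) :=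
  (integrable_inv_one_add_sq.comp_snd μ).bdd_mul (c := ‖f‖)
    (Continuous.aestronglyMeasurable (by fun_prop))
    (Eventually.of_forall fun p => f.norm_coe_le_norm _)

lemma integral_mul_im_cauchyTransform (μ : Measure ℝ) [IsFiniteMeasure μ] (f : ℝ →ᵇ ℝ) {η : ℝ}
    (hη : 0 < η) :
    ∫ x : ℝ, f x * (cauchyTransform μ (x - η * Complex.I)).im
      = ∫ p : ℝ × ℝ, f (p.1 + η * p.2) * (1 + p.2 ^ 2)⁻¹ ∂(μ.prod volume) := by
  rw [integral_prod _ (integrable_mul_inv_one_add_sq μ f η)]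
  simp_rw [← integral_mul_poissonKer hη, im_cauchyTransform_lower μ hη, ← integral_const_mul]
  refine integral_integral_swap ?_
  exact (integrable_poissonKer_sub μ hη).bdd_mul (c := ‖f‖)
    (Continuous.aestronglyMeasurable (by fun_prop))
    (Eventually.of_forall fun p => f.norm_coe_le_norm _)

/-- Stieltjes inversion in weak form; approaching from below the axis makes the imaginary part
positive. -/
lemma tendsto_integral_mul_im_cauchyTransform (μ : Measure ℝ) [IsFiniteMeasure μ] (f : ℝ →ᵇ ℝ) :
    Tendsto (fun η : ℝ => ∫ x : ℝ, f x * (cauchyTransform μ (x - η * Complex.I)).im) (𝓝[>] 0)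
      (𝓝 ((∫ x, f x ∂μ) * Real.pi)) := by
  rw [← integral_univ_inv_one_add_sq, ← integral_prod_mul]
  have hlim : Tendsto (fun η : ℝ =>
      ∫ p : ℝ × ℝ, f (p.1 + η * p.2) * (1 + p.2 ^ 2)⁻¹ ∂(μ.prod volume)) (𝓝[>] 0)
      (𝓝 (∫ p : ℝ × ℝ, f p.1 * (1 + p.2 ^ 2)⁻¹ ∂(μ.prod volume))) := by
    refine tendsto_integral_filter_of_dominated_convergence
      (fun p : ℝ × ℝ => ‖f‖ * (1 + p.2 ^ 2)⁻¹) ?_ ?_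
      ((integrable_inv_one_add_sq.comp_snd μ).const_mul _) ?_
    · exact Eventually.of_forall fun η => (integrable_mul_inv_one_add_sq μ f η).1
    · refine Eventually.of_forall fun η => Eventually.of_forall fun p => ?_
      rw [norm_mul, Real.norm_of_nonneg (by positivity : (0 : ℝ) ≤ (1 + p.2 ^ 2)⁻¹)]
      gcongr
      exact f.norm_coe_le_norm _
    · refine Eventually.of_forall fun p => ?_
      have hc : Continuous fun η : ℝ => f (p.1 + η * p.2) * (1 + p.2 ^ 2)⁻¹ := by fun_prop
      exact (hc.tendsto' 0 _ (by simp)).mono_left nhdsWithin_le_nhds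
  refine hlim.congr' ?_
  filter_upwards [self_mem_nhdsWithin] with η hη
  exact (integral_mul_im_cauchyTransform μ f hη).symm

lemma eq_of_cauchyTransform_eq {μ ν : Measure ℝ} [IsFiniteMeasure μ] [IsFiniteMeasure ν]
    (h : EqOn (cauchyTransform μ) (cauchyTransform ν) {z | z.im < 0}) : μ = ν := by
  refine ext_of_forall_integral_eq_of_IsFiniteMeasure fun f => ?_
  have h1 := tendsto_integral_mul_im_cauchyTransform μ f
  have h2 := tendsto_integral_mul_im_cauchyTransform ν f
  refine mul_right_cancel₀ Real.pi_ne_zero (tendsto_nhds_unique h1 (h2.congr' ?_))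
  filter_upwards [self_mem_nhdsWithin] with η hη
  congr 1
  ext x
  rw [h (show ((x : ℂ) - η * Complex.I).im < 0 by simpa using hη)]

lemma analyticOnNhd_cauchyTransform (μ : Measure ℝ) [IsFiniteMeasure μ] :
    AnalyticOnNhd ℂ (cauchyTransform μ) {z | z.im < 0} :=
  DifferentiableOn.analyticOnNhd
    (fun _ hz => (differentiableAt_cauchyTransform μ (ne_of_lt hz)).differentiableWithinAt)
    (isOpen_lt Complex.continuous_im continuous_const)

/-! ### Convergence of R-transforms and weak convergence -/

lemma tendsto_cauchyTransform {ι : Type*} {F : Filter ι} {ν : ι → ProbabilityMeasure ℝ}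
    {μ : ProbabilityMeasure ℝ} (h : Tendsto ν F (𝓝 μ)) {z : ℂ} (hz : z.im ≠ 0) :
    Tendsto (fun i => cauchyTransform (ν i) z) F (𝓝 (cauchyTransform μ z)) :=
  (ProbabilityMeasure.tendsto_iff_forall_integral_rclike_tendsto ℂ).1 h
    (BoundedContinuousFunction.ofNormedAddCommGroup (fun t : ℝ => 1 / (z - (t : ℂ)))
      (continuous_one_div_sub_ofReal hz) (1 / |z.im|) (norm_one_div_sub_ofReal_le hz))

/-- Chebyshev's inequality: the mass outside `[-r, r]` is at most `1/r²`. -/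
lemma isTightMeasureSet_of_isStandardized {S : Set (Measure ℝ)}
    (hS : ∀ μ ∈ S, IsProbabilityMeasure μ ∧ IsStandardized μ) : IsTightMeasureSet S := by
  refine isTightMeasureSet_of_tendsto_measure_norm_gt ?_
  have hlim : Tendsto (fun r : ℝ => ENNReal.ofReal (1 / r ^ 2)) atTop (𝓝 0) := by
    rw [← ENNReal.ofReal_zero]
    refine ENNReal.tendsto_ofReal ?_
    simp only [one_div]
    exact (tendsto_pow_atTop two_ne_zero).inv_tendsto_atTop
  refine tendsto_of_tendsto_of_tendsto_of_le_of_le' tendsto_const_nhds hlim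
    (Eventually.of_forall fun _ => zero_le) ?_
  filter_upwards [eventually_gt_atTop 0] with r hr
  refine iSup₂_le fun μ hμ => ?_
  obtain ⟨_, h⟩ := hS μ hμ
  have h1 := mul_meas_ge_le_integral_of_nonneg (μ := μ) (f := fun x : ℝ => x ^ 2)
    (Eventually.of_forall fun x => sq_nonneg x) h.memLp.integrable_sq (r ^ 2)
  rw [h.variance, ← le_div_iff₀' (by positivity)] at h1
  rw [← ofReal_measureReal]
  refine ENNReal.ofReal_le_ofReal (le_trans (measureReal_mono ?_) h1)
  intro x hx
  have hx' : r < |x| := hx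
  show r ^ 2 ≤ x ^ 2
  rw [← sq_abs x]
  gcongr

lemma tendsto_rTransform {ν : ℕ → Q3} {μ : Q3}
    (h : Tendsto (fun n => rDist (ν n) μ) atTop (𝓝 0)) {y : ℝ} (hy : y ∈ Ioc (0 : ℝ) (1 / 4)) :
    Tendsto (fun n => ‖rTransform (ν n) (y * Complex.I) - rTransform μ (y * Complex.I)‖) atTop
      (𝓝 0) := by
  have hpos : 0 < y ^ 2 := pow_pos hy.1 2
  have h1 : Tendsto (fun n => (rDist (ν n) μ).toReal * y ^ 2) atTop (𝓝 0) := by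
    simpa using ((ENNReal.tendsto_toReal ENNReal.zero_ne_top).comp h).mul_const (y ^ 2)
  refine squeeze_zero (fun _ => norm_nonneg _) (fun n => ?_) h1
  rw [← div_le_iff₀ hpos, ← ENNReal.ofReal_le_iff_le_toReal (rDist_lt_top _ _).ne]
  exact le_iSup₂ (f := fun y (_ : y ∈ Ioc (0 : ℝ) (1 / 4)) =>
    ENNReal.ofReal (‖rTransform (ν n) (y * Complex.I) - rTransform μ (y * Complex.I)‖ / y ^ 2)) y hy

/-- Let `ζ`, `ζ_n` be the inverse points of `μ`, `ν_n` at `1/(iy)`. Then `G_{ν_n}(ζ_n) = iy`, and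
since both points have `|Im| > 1`, `|G_{ν_n}(ζ) - iy| ≤ |ζ - ζ_n| = |R_{ν_n}(iy) - R_μ(iy)| → 0`. -/
lemma cauchyTransform_eq_of_tendsto {F : Filter ℕ} [F.NeBot] (hF : F ≤ atTop) {ν : ℕ → Q3} {μ : Q3}
    (h : Tendsto (fun n => rDist (ν n) μ) atTop (𝓝 0)) {μ' : ProbabilityMeasure ℝ}
    (hμ' : Tendsto (fun n => (ν n).1) F (𝓝 μ')) {y : ℝ} (hy : y ∈ Ioc (0 : ℝ) (1 / 4)) :
    cauchyTransform μ' (cauchyRecipInv μ.1 (1 / (y * Complex.I))) = y * Complex.I := by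
  have hz := ofReal_mul_I_mem_rDomain_of_mem_Ioc hy
  have hw := two_lt_abs_im_one_div hz
  have hζ := (isStandardized_of_mem_Q3 μ).one_lt_abs_im_cauchyRecipInv hw
  refine tendsto_nhds_unique (tendsto_cauchyTransform hμ' (ne_zero_of_one_lt_abs hζ)) ?_
  rw [tendsto_iff_norm_sub_tendsto_zero]
  refine squeeze_zero (fun _ => norm_nonneg _) (fun n => ?_) ((tendsto_rTransform h hy).mono_left hF)
  have hζn := (isStandardized_of_mem_Q3 (ν n)).one_lt_abs_im_cauchyRecipInv hw
  have h1 := norm_cauchyTransform_sub_le ((ν n).1 : Measure ℝ) (ne_zero_of_one_lt_abs hζ)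
    (ne_zero_of_one_lt_abs hζn)
  rw [(isStandardized_of_mem_Q3 (ν n)).cauchyTransform_cauchyRecipInv hw, one_div_one_div] at h1
  rw [rTransform_eq _ hz, rTransform_eq _ hz, sub_sub_sub_cancel_right, norm_sub_rev
    (cauchyRecipInv ((ν n).1 : Measure ℝ) _)]
  exact h1.trans (div_le_self (norm_nonneg _) (by nlinarith))

lemma im_cauchyRecipInv_neg {μ : Measure ℝ} [IsProbabilityMeasure μ] (h : IsStandardized μ)
    {w : ℂ} (hw : w.im < -2) : (cauchyRecipInv μ w).im < 0 := by
  have h1 := h.cauchyRecipInv_mem (w := w) (by rw [abs_of_neg (by linarith)]; linarith)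
  rw [mem_closedBall_iff_norm] at h1
  have h2 := (Complex.im_le_norm _).trans h1
  rw [Complex.sub_im] at h2
  linarith

/-- The curve never revisits its base point because `G_μ` recovers `iy` from it; thus its image
accumulates there, as the identity theorem requires. -/
lemma IsStandardized.tendsto_cauchyRecipInv_nhdsNE {μ : Measure ℝ} [IsProbabilityMeasure μ]
    (h : IsStandardized μ) {y₀ : ℝ} (h0 : y₀ ≠ 0) (hy₀ : |y₀| < 1 / 2) :
    Tendsto (fun y : ℝ => cauchyRecipInv μ (1 / (y * Complex.I))) (𝓝[≠] y₀)
      (𝓝[≠] (cauchyRecipInv μ (1 / (y₀ * Complex.I)))) := by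
  have hz := ofReal_mul_I_mem_rDomain h0 hy₀
  rw [tendsto_nhdsWithin_iff]
  constructor
  · have h1 : ContinuousAt (fun y : ℝ => 1 / (y * Complex.I : ℂ)) y₀ :=
      continuousAt_const.div (by fun_prop) (ne_zero_of_mem_rDomain hz)
    exact Tendsto.mono_left (ContinuousAt.comp (g := cauchyRecipInv μ)
      (h.continuousAt_cauchyRecipInv (two_lt_abs_im_one_div hz)) h1) nhdsWithin_le_nhds
  · have h2 : ∀ᶠ y : ℝ in 𝓝[≠] y₀, y ≠ 0 ∧ |y| < 1 / 2 :=
      mem_nhdsWithin_of_mem_nhds (Filter.inter_mem (isOpen_ne.mem_nhds h0)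
        ((isOpen_lt continuous_abs continuous_const).mem_nhds hy₀))
    filter_upwards [self_mem_nhdsWithin, h2] with y hne hy heq
    have h3 := congrArg (cauchyTransform μ) heq
    rw [h.cauchyTransform_cauchyRecipInv (two_lt_abs_im_one_div hz),
      h.cauchyTransform_cauchyRecipInv
        (two_lt_abs_im_one_div (ofReal_mul_I_mem_rDomain hy.1 hy.2)),
      one_div_one_div, one_div_one_div] at h3
    exact hne (by simpa using h3)

lemma tendsto_of_tendsto_rDist {ν : ℕ → Q3} {μ : Q3}
    (h : Tendsto (fun n => rDist (ν n) μ) atTop (𝓝 0)) :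
    Tendsto (fun n => (ν n).1) atTop (𝓝 μ.1) := by
  have hμ := isStandardized_of_mem_Q3 μ
  -- Along an ultrafilter, relative compactness gives a limit `μ'` without extracting subsequences;
  -- it remains to show `μ' = μ`.
  refine (tendsto_iff_ultrafilter _ _ _).2 fun U hU => ?_
  have hcomp : IsCompact (closure (range fun n => (ν n).1)) := by
    refine isCompact_closure_of_isTightMeasureSet (isTightMeasureSet_of_isStandardized ?_)
    rintro _ ⟨_, ⟨n, rfl⟩, rfl⟩
    exact ⟨inferInstance, isStandardized_of_mem_Q3 (ν n)⟩
  obtain ⟨μ', -, hμ'⟩ := hcomp.ultrafilter_le_nhds (U.map fun n => (ν n).1)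
    (le_principal_iff.2 (mem_map.2 (univ_mem' fun n => subset_closure (mem_range_self n))))
  replace hμ' : Tendsto (fun n => (ν n).1) U (𝓝 μ') := hμ'
  suffices (μ' : Measure ℝ) = μ.1 by
    rwa [Subtype.ext this] at hμ'
  -- Any interior point of `(0, 1/4]` would serve as base point of the curve.
  have hpos : (1 / 8 : ℝ) ≠ 0 := by norm_num
  have hlt : |(1 / 8 : ℝ)| < 1 / 2 := by rw [abs_of_pos] <;> norm_num
  refine eq_of_cauchyTransform_eq ((analyticOnNhd_cauchyTransform _).eqOn_of_eventually_eq_comp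
    (analyticOnNhd_cauchyTransform _) (convex_halfSpace_im_lt 0).isPreconnected
    (im_cauchyRecipInv_neg hμ ?_) (hμ.tendsto_cauchyRecipInv_nhdsNE hpos hlt) ?_)
  · rw [one_div, Complex.inv_im]
    simp [Complex.normSq_apply]
    norm_num
  · refine Eventually.filter_mono nhdsWithin_le_nhds ?_
    filter_upwards [Ioc_mem_nhds (show (0 : ℝ) < 1 / 8 by norm_num)
      (show (1 / 8 : ℝ) < 1 / 4 by norm_num)] with y hy
    rw [cauchyTransform_eq_of_tendsto hU h hμ' hy, hμ.cauchyTransform_cauchyRecipInv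
      (two_lt_abs_im_one_div (ofReal_mul_I_mem_rDomain_of_mem_Ioc hy)), one_div_one_div]

lemma rDist_eq_zero_iff (μ ν : Q3) : rDist μ ν = 0 ↔ μ = ν := by
  refine ⟨fun h => ?_, fun h => h ▸ rDist_self μ⟩
  have h1 : Tendsto (fun _ : ℕ => rDist μ ν) atTop (𝓝 0) := by
    rw [h]
    exact tendsto_const_nhds
  exact Subtype.ext (tendsto_nhds_unique tendsto_const_nhds (tendsto_of_tendsto_rDist h1))

end

theorem mainTheorem3 :
    -- the R-transform is well defined on `Q3`
    (∀ μ : Q3, IsRTransform (μ.1 : Measure ℝ) (rTransform μ) ∧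
      ∀ R : ℂ → ℂ, IsRTransform (μ.1 : Measure ℝ) R → EqOn R (rTransform μ) rDomain) ∧
    -- `R_μ(z) = z + α₃ z² + o(z²)` as `z = iy → 0`
    (∀ μ : Q3,
      (fun y : ℝ => rTransform μ (y * Complex.I) -
        ((y * Complex.I) + ((∫ x : ℝ, x ^ 3 ∂(μ.1 : Measure ℝ) : ℝ) : ℂ) * (y * Complex.I) ^ 2))
        =o[𝓝[≠] 0] (fun y : ℝ => y ^ 2)) ∧
    -- `d` is a finite metric
    (∀ μ ν : Q3, rDist μ ν < ∞) ∧
    (∀ μ ν : Q3, rDist μ ν = 0 ↔ μ = ν) ∧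
    (∀ μ ν : Q3, rDist μ ν = rDist ν μ) ∧
    (∀ μ ν ξ : Q3, rDist μ ξ ≤ rDist μ ν + rDist ν ξ) ∧
    -- convergence in `d` implies weak convergence
    (∀ (ν : ℕ → Q3) (μ : Q3), Tendsto (fun n => rDist (ν n) μ) atTop (𝓝 0) →
      Tendsto (fun n => (ν n).1) atTop (𝓝 μ.1)) := by
  refine ⟨fun μ => ⟨isRTransform_rTransform μ, fun R hR => hR.eqOn (isStandardized_of_mem_Q3 μ)
    (isRTransform_rTransform μ)⟩, fun μ => ?_, rDist_lt_top, rDist_eq_zero_iff, rDist_comm,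
    rDist_triangle, fun _ _ => tendsto_of_tendsto_rDist⟩
  refine ((isStandardized_of_mem_Q3 μ).isLittleO_rTransform μ.2.1).congr' ?_ EventuallyEq.rfl
  filter_upwards [eventually_ofReal_mul_I_mem_rDomain] with y hy
  rw [rTransform_eq μ hy]
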